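/- Let $\mathcal I_f$ be the set of Borel subsets of $\mathbb R$ of positive finite Lebesgue measure, let $\mathcal I_\infty$ be the set of Borel subsets of $\mathbb R$ that contain $(a,+\infty)$ or $(-\infty,a)$ for some $a\in\mathbb R$, and let $\mathcal I=\mathcal I_f\cup\mathcal I_\infty$. For $x\in L_2(\mathbb R)$ (complex valued), let $X(i\omega)=\int_{\mathbb R}e^{-i\omega t}x(t)\,dt$ be its Fourier transform, understood in the $L_2$ sense. Let $m\ge 1$ and let $\mathcal T=(\Gamma,I,h)$, where $\Gamma$ is a set of ordered pairs $(d,k)$ with $d,k\in\{1,\dots,m\}$, $d\ne k$, such that $(d,k)\in\Gamma$ implies $(k,d)\notin\Gamma$, and where to each $(d,k)\in\Gamma$ are assigned a set $I_{d,k}\in\mathcal I$ and a continuous (not necessarily linear) map $h_{d,k}:L_2(\mathbb R)\to L_2(\mathbb R)$. Let $\Omega>0$, $\tau\in(0,\pi/\Omega)$, and let $G=(G_1,\dots,G_m)$ be such that $G_1=\mathbb R\setminus[-\Omega,\Omega]$ and $G_d\in\mathcal I$ for $d\ge 2$. Let $\mathcal L^G_{2,\mathcal T}$ be the set of all $\{x_d\}_{d=1}^m\in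 [L_2(\mathbb R)]^m$ (the $\mathcal T$-branched processes with spectrum gaps $G$) such that - for each $(d,k)\in\Gamma$, $x_k(t)=(h_{d,k}x_d)(t)$ for almost every $t\in I_{d,k}$, and - for each $d\in\{1,\dots,m\}$, $X_d(i\omega)=0$ for almost every $\omega\in G_d$ (in particular $x_1$ is band-limited to $[-\Omega,\Omega]$). Assume that for every $d\in\{2,\dots,m\}$ there exist $j\ge 0$ and $d_0,d_1,\dots,d_{j+1}\in\{1,\dots,m\}$ with $d_0=1$ and $d_{j+1}=d$ such that, for $k=1,\dots,j+1$, $(d_{k-1},d_k)\in\Gamma$ and the set $I_{d_{k-1},d_k}\cup G_{d_k}$ has infinite Lebesgue measure. Then for any $s\in\mathbb Z$, a process $\{x_d\}_{d=1}^m\in\mathcal L^G_{2,\mathcal T}$ is uniquely determined in $\mathcal L^G_{2,\mathcal T}$, up to almost everywhere equality, by the sequence $\{x_1(\tau k)\}_{k\in\mathbb Z,\ k\le s}$. That is, the first component of any process in $\mathcal L^G_{2,\mathcal T}$ has a unique continuous representative, and if $\{x_d\}_{d=1}^m$ and $\{y_d\}_{d=1}^m$ in $\mathcal L^G_{2,\mathcal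 T}$ are such that the continuous representatives of $x_1$ and $y_1$ satisfy $x_1(\tau k)=y_1(\tau k)$ for all integers $k\le s$, then $x_d=y_d$ almost everywhere for every $d\in\{1,\dots,m\}$. -/

import Mathlib

open MeasureTheory Set
open scoped FourierTransform

namespace BranchedProcess

/-- The complex Hilbert space `L₂(ℝ)` (Lebesgue measure); its elements are classes of functions
modulo almost everywhere equality. -/
abbrev L2 : Type := Lp ℂ 2 (volume : Measure ℝ)

/-- Borel subsets of `ℝ` of positive finite Lebesgue measure. -/
def finiteSets : Set (Set ℝ) :=
  {B | MeasurableSet B ∧ 0 < volume B ∧ volume B < ⊤}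

/-- Borel subsets of `ℝ` that contain an open half-line, on the left or on the right. -/
def infiniteSets : Set (Set ℝ) :=
  {B | MeasurableSet B ∧ ∃ a : ℝ, Ioi a ⊆ B ∨ Iio a ⊆ B}

/-- The admissible sets, both for the places where branches are glued and for spectrum gaps. -/
def admissibleSets : Set (Set ℝ) := finiteSets ∪ infiniteSets

/-- The `L₂` Fourier transform in the angular frequency normalization
`X(iω) = ∫ exp(-iωt) x(t) dt`. Mathlib's `𝓕` has the kernel `exp(-2πiξt)`, so `X(iω)` is its value
at `ξ = ω / (2π)`. As always in `L₂`, this function is meaningful up to a null set of `ω`. -/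
noncomputable def angularFourier (x : L2) : ℝ → ℂ :=
  fun ω => (𝓕 x : L2) (ω / (2 * Real.pi))

/-- A branching structure `(Γ, I, h)` on `m` branches: a set `Γ` of ordered pairs of distinct
branches which never contains both `(d, k)` and `(k, d)`, an admissible set `I e` and a continuous
(possibly nonlinear) map `h e : L₂(ℝ) → L₂(ℝ)` for each `e ∈ Γ`. -/
structure Structure (m : ℕ) where
  Γ : Set (Fin m × Fin m)
  ne_of_mem : ∀ d k : Fin m, (d, k) ∈ Γ → d ≠ k
  swap_notMem : ∀ d k : Fin m, (d, k) ∈ Γ → (k, d) ∉ Γ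
  I : Γ → admissibleSets
  h : Γ → C(L2, L2)

variable {m : ℕ}

/-- The branched processes for `T`: families `(x_d)` in `L₂(ℝ)` such that, for each
`(d, k) ∈ Γ`, `x_k = h_{d,k}(x_d)` almost everywhere on `I_{d,k}`. -/
def processes (T : Structure m) : Set (Fin m → L2) :=
  {x | ∀ e : T.Γ, ∀ᵐ t : ℝ, t ∈ (T.I e : Set ℝ) → x e.1.2 t = T.h e (x e.1.1) t}

/-- The branched processes for `T` with spectrum gaps `G = (G_d)`: the Fourier transform of `x_d`
vanishes (almost everywhere) on `G_d`, for every branch `d`. -/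
def gapProcesses (T : Structure m) (G : Fin m → Set ℝ) : Set (Fin m → L2) :=
  {x | x ∈ processes T ∧ ∀ d : Fin m, ∀ᵐ ω : ℝ, ω ∈ G d → angularFourier (x d) ω = 0}

/-- There is a chain `d₀ = p 0, p 1, …, p j, p (j + 1) = d` of branches, `j ≥ 0`, such that each
consecutive pair is in `Γ` and, for each step, the union of the gluing set of the step and of the
spectrum gap of the branch it arrives at has infinite measure. -/
def ReachesWithGaps (T : Structure m) (G : Fin m → Set ℝ) (d₀ d : Fin m) : Prop :=
  ∃ (j : ℕ) (p : Fin (j + 2) → Fin m), p 0 = d₀ ∧ p (Fin.last (j + 1)) = d ∧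
    ∀ k : Fin (j + 1), ∃ hk : (p k.castSucc, p k.succ) ∈ T.Γ,
      volume ((T.I ⟨(p k.castSucc, p k.succ), hk⟩ : Set ℝ) ∪ G (p k.succ)) = ⊤

end BranchedProcess

/-!
Two processes with the same samples of the first branch first agree on that branch, and then on every
branch reached along a chain of gluings. Each step is an instance of one uniqueness principle: an
`L²` function with one-sided spectrum which vanishes on a set of positive measure is zero.

* Samples. Let `f` be band-limited to `[-Ω, Ω]`, with continuous representative zero at `τ k` for all
  `k ≤ s`. These samples are the Fourier coefficients of `𝓕 f`, seen as a function on the circle of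
  length `1 / τ` (in the frequency variable of Mathlib). So half of the coefficients vanish, and
  since `τ < π / Ω`, the function vanishes on an arc
  (`ae_eq_zero_of_fourierCoeff_eq_zero`).
* Gluings. The difference `f` of two branches vanishes on a gluing set and its Fourier transform on a
  gap. Their union having infinite measure, one of them contains a half-line, while the other has
  positive measure (`eq_zero_of_fourier_eq_zero_on_halfLine`, `eq_zero_of_eq_zero_on_halfLine`).

The uniqueness principle is proved by Hilbert space methods, following Wiener and Helson. Let `K` be a
closed subspace of `L²` invariant under multiplication by a unimodular coordinate `z`, all of whose
elements vanish on `E` with `|E| > 0`. If `K` were not invariant under `z⁻¹`, there would be a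
nonzero `q ⟂ K` with `z q ∈ K`; then `|q|²` has no nontrivial moments against `zⁿ`, so it is a
multiple of a nowhere vanishing weight, although `q` vanishes on `E`
(`inv_mul_mem_of_shift_invariant`). Hence `K` is a module over all multipliers
(`mul_mem_of_shift_invariant`), which is incompatible with one-sided spectrum unless `K = 0`. On the
circle `z` is the standard coordinate; on the line it is the Cayley transform, an average of the
characters `exp(iσbx)` with `b ≥ 0` (`cayley_mul_mem`).
-/

/-! ### Integrable functions are determined by their moments -/

/-- If all the integer moments of `φ` with respect to a map `θ` to the circle vanish, so does
`∫ φ (g ∘ θ)` for every continuous `g`, because trigonometric polynomials are dense. -/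
lemma integral_mul_comp_addCircle_eq_zero {X : Type*} [MeasurableSpace X] {μ : Measure X} {T : ℝ}
    [Fact (0 < T)] {θ : X → AddCircle T} (hθ : Measurable θ) {φ : X → ℂ} (hφ : Integrable φ μ)
    (h : ∀ n : ℤ, ∫ x, φ x * fourier n (θ x) ∂μ = 0) (g : C(AddCircle T, ℂ)) :
    ∫ x, φ x * g (θ x) ∂μ = 0 := by
  have hint : ∀ k : C(AddCircle T, ℂ), Integrable (fun x => φ x * k (θ x)) μ := fun k =>
    hφ.mul_bdd (c := ‖k‖) (k.continuous.measurable.comp hθ).aestronglyMeasurable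
      (ae_of_all _ fun x => k.norm_coe_le_norm _)
  let Λ : C(AddCircle T, ℂ) →L[ℂ] ℂ := LinearMap.mkContinuous
    { toFun := fun k => ∫ x, φ x * k (θ x) ∂μ
      map_add' := fun k l => by
        rw [← integral_add (hint k) (hint l)]
        simp [mul_add]
      map_smul' := fun c k => by
        simp only [ContinuousMap.smul_apply, smul_eq_mul, RingHom.id_apply]
        rw [← integral_const_mul]
        congr 1; ext x; ring } (∫ x, ‖φ x‖ ∂μ) (fun k => by
      change ‖∫ x, φ x * k _ ∂μ‖ ≤ _
      rw [← integral_mul_const]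
      refine norm_integral_le_of_norm_le (hφ.norm.mul_const _) (ae_of_all _ fun x => ?_)
      rw [norm_mul]
      gcongr
      exact k.norm_coe_le_norm _)
  have hΛ : Λ = 0 := by
    have hd : Dense (Submodule.span ℂ (range (@fourier T)) : Set C(AddCircle T, ℂ)) := by
      rw [Submodule.dense_iff_topologicalClosure_eq_top]
      exact span_fourier_closure_eq_top
    refine ContinuousLinearMap.ext_on hd ?_
    rintro _ ⟨n, rfl⟩
    exact h n
  exact congrArg (fun L : C(AddCircle T, ℂ) →L[ℂ] ℂ => L g) hΛ

/-- The real case of `ae_eq_zero_of_moments_eq_zero`: the images on the circle of the positive and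
negative parts of `φ` are finite measures with the same integrals of continuous functions, hence
equal, and by injectivity of `θ` no information is lost in passing to the images. -/
lemma ae_eq_zero_of_moments_eq_zero_real {X : Type*} [MeasurableSpace X] [StandardBorelSpace X]
    {μ : Measure X} {T : ℝ} [Fact (0 < T)] {θ : X → AddCircle T} (hθ : Measurable θ)
    {s : Set X} (hs : MeasurableSet s)
    (hμs : μ sᶜ = 0) (hinj : InjOn θ s) {φ : X → ℝ} (hφ : Integrable φ μ)
    (h : ∀ n : ℤ, ∫ x, (φ x : ℂ) * fourier n (θ x) ∂μ = 0) : φ =ᵐ[μ] 0 := by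
  have hfin : ∀ ψ : X → ℝ, Integrable ψ μ →
      IsFiniteMeasure (μ.withDensity fun x => ENNReal.ofReal (ψ x)) := fun ψ hψ =>
    isFiniteMeasure_withDensity_ofReal hψ.2
  have := hfin _ hφ
  have := hfin _ hφ.neg
  have hint : ∀ (ψ : X → ℝ), Integrable ψ μ → ∀ g : BoundedContinuousFunction (AddCircle T) ℝ,
      ∫ c, g c ∂((μ.withDensity fun x => ENNReal.ofReal (ψ x)).map θ)
        = ∫ x, max (ψ x) 0 * g (θ x) ∂μ := by
    intro ψ hψ g
    rw [integral_map hθ.aemeasurable g.continuous.aestronglyMeasurable,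
      integral_withDensity_eq_integral_toReal_smul₀ hψ.aemeasurable.ennreal_ofReal
        (ae_of_all _ fun x => ENNReal.ofReal_lt_top)]
    simp [ENNReal.toReal_ofReal']
  have hmap : (μ.withDensity fun x => ENNReal.ofReal (φ x)).map θ
      = (μ.withDensity fun x => ENNReal.ofReal ((-φ) x)).map θ := by
    refine ext_of_forall_integral_eq_of_IsFiniteMeasure fun g => ?_
    rw [hint _ hφ, hint _ hφ.neg, ← sub_eq_zero]
    have hb : ∀ ψ : X → ℝ, Integrable ψ μ →
        Integrable (fun x => max (ψ x) 0 * g (θ x)) μ := fun ψ hψ =>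
      hψ.pos_part.mul_bdd (c := ‖g‖) (g.continuous.measurable.comp hθ).aestronglyMeasurable
        (ae_of_all _ fun x => g.norm_coe_le_norm _)
    rw [← integral_sub (hb _ hφ) (hb _ hφ.neg)]
    have h0 := integral_mul_comp_addCircle_eq_zero hθ hφ.ofReal h
      ⟨fun c => (g c : ℂ), Complex.continuous_ofReal.comp g.continuous⟩
    have h1 : ∫ x, φ x * g (θ x) ∂μ = 0 := by
      rw [← Complex.ofReal_inj, ← integral_complex_ofReal]
      simpa using h0
    refine Eq.trans ?_ h1
    congr 1; ext x
    rw [← sub_mul]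
    congr 1
    simp only [Pi.neg_apply]
    rcases le_total (φ x) 0 with hx | hx
    · rw [max_eq_right hx, max_eq_left (by linarith)]; ring
    · rw [max_eq_left hx, max_eq_right (by linarith)]; ring
  have heq : (μ.withDensity fun x => ENNReal.ofReal (φ x))
      = μ.withDensity fun x => ENNReal.ofReal ((-φ) x) := by
    have key : ∀ f : X → ENNReal, ∀ A : Set X, MeasurableSet A →
        μ.withDensity f A = (μ.withDensity f).map θ (θ '' (A ∩ s)) := by
      intro f A hA
      rw [Measure.map_apply hθ ((hA.inter hs).image_of_measurable_injOn hθ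
        (hinj.mono inter_subset_right))]
      refine measure_congr ?_
      have : ∀ᵐ x ∂(μ.withDensity f), x ∈ s :=
        (withDensity_absolutelyContinuous μ f).ae_le (measure_eq_zero_iff_ae_notMem.1 hμs |>.mono
          fun x hx => by simpa using hx)
      filter_upwards [this] with x hx
      refine propext ⟨fun hxA => ⟨x, ⟨hxA, hx⟩, rfl⟩, ?_⟩
      rintro ⟨y, ⟨hyA, hys⟩, hy⟩
      exact hinj hys hx hy ▸ hyA
    ext A hA
    rw [key _ A hA, key _ A hA, hmap]
  have h2 := (withDensity_eq_iff hφ.aemeasurable.ennreal_ofReal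
    hφ.neg.aemeasurable.ennreal_ofReal (by
      rw [← lt_top_iff_ne_top, ← setLIntegral_univ, ← withDensity_apply _ MeasurableSet.univ]
      exact measure_lt_top _ _)).1 heq
  filter_upwards [h2] with x hx
  by_contra hne
  rcases lt_or_gt_of_ne hne with hlt | hlt
  · have : (0 : ℝ) < -φ x := by simpa using hlt
    rw [ENNReal.ofReal_of_nonpos (by simpa using hlt.le), Pi.neg_apply, eq_comm,
      ENNReal.ofReal_eq_zero] at hx
    linarith
  · have : (0 : ℝ) < φ x := hlt
    rw [ENNReal.ofReal_of_nonpos (p := (-φ) x) (by simpa using this.le),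
      ENNReal.ofReal_eq_zero] at hx
    linarith

/-- An integrable function is determined by its integer moments with respect to a map `θ`
to the circle which is injective up to a null set. -/
theorem ae_eq_zero_of_moments_eq_zero {X : Type*} [MeasurableSpace X] [StandardBorelSpace X]
    {μ : Measure X} {T : ℝ} [Fact (0 < T)] {θ : X → AddCircle T} (hθ : Measurable θ)
    {s : Set X} (hs : MeasurableSet s)
    (hμs : μ sᶜ = 0) (hinj : InjOn θ s) {φ : X → ℂ} (hφ : Integrable φ μ)
    (h : ∀ n : ℤ, ∫ x, φ x * fourier n (θ x) ∂μ = 0) : φ =ᵐ[μ] 0 := by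
  have hθn : ∀ n : ℤ, Measurable fun x => (fourier n (θ x) : ℂ) := fun n =>
    (fourier n).continuous.measurable.comp hθ
  have hint : ∀ (ψ : X → ℂ), Integrable ψ μ → ∀ n : ℤ,
      Integrable (fun x => ψ x * fourier n (θ x)) μ := fun ψ hψ n =>
    hψ.mul_bdd (c := 1) (hθn n).aestronglyMeasurable (ae_of_all _ fun x => by
      rw [fourier_apply]; exact (Circle.norm_coe _).le)
  have hc : Integrable (fun x => (starRingEnd ℂ) (φ x)) μ := by
    exact Complex.conjCLE.integrable_comp_iff.2 hφ
  have hconj : ∀ n : ℤ, ∫ x, (starRingEnd ℂ) (φ x) * fourier n (θ x) ∂μ = 0 := by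
    intro n
    have h1 := congrArg (starRingEnd ℂ) (h (-n))
    rw [← integral_conj, map_zero] at h1
    rw [← h1]
    congr 1; ext x
    rw [map_mul, fourier_neg, Complex.conj_conj]
  have hre : (fun x => (φ x).re) =ᵐ[μ] 0 := by
    refine ae_eq_zero_of_moments_eq_zero_real hθ hs hμs hinj hφ.re fun n => ?_
    have : ∀ x, ((φ x).re : ℂ) * fourier n (θ x)
        = (1 / 2) * (φ x * fourier n (θ x) + (starRingEnd ℂ) (φ x) * fourier n (θ x)) := fun x => by
      rw [Complex.re_eq_add_conj]; ring
    simp_rw [this]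
    rw [integral_const_mul, integral_add (hint _ hφ n) (hint _ hc n), h, hconj]
    simp
  have him : (fun x => (φ x).im) =ᵐ[μ] 0 := by
    refine ae_eq_zero_of_moments_eq_zero_real hθ hs hμs hinj hφ.im fun n => ?_
    have : ∀ x, ((φ x).im : ℂ) * fourier n (θ x) = (1 / (2 * Complex.I)) *
        (φ x * fourier n (θ x) - (starRingEnd ℂ) (φ x) * fourier n (θ x)) := fun x => by
      rw [Complex.im_eq_sub_conj]; ring
    simp_rw [this]
    rw [integral_const_mul, integral_sub (hint _ hφ n) (hint _ hc n), h, hconj]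
    simp
  filter_upwards [hre, him] with x h1 h2
  exact Complex.ext h1 h2

/-! ### Shift-invariant subspaces of `L²` -/

lemma exists_Lp_ae_eq_mul {X : Type*} [MeasurableSpace X] {μ : Measure X} {u : X → ℂ}
    (hu : AEStronglyMeasurable u μ) {C : ℝ} (hC : ∀ x, ‖u x‖ ≤ C) (f : Lp ℂ 2 μ) :
    ∃ g : Lp ℂ 2 μ, g =ᵐ[μ] fun x => u x * f x := by
  have : MemLp (fun x => u x * f x) 2 μ := by
    refine MemLp.of_le_mul (c := C) (Lp.memLp f) (hu.mul (Lp.aestronglyMeasurable f))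
      (ae_of_all _ fun x => ?_)
    rw [norm_mul]
    gcongr
    exact hC x
  exact ⟨this.toLp _, this.coeFn_toLp⟩

/-- **Wiener's argument**: a closed subspace `K` of `L²` which is invariant under multiplication by
the circle coordinate `z`, and whose elements all vanish on one set of positive measure, is also
invariant under multiplication by `z⁻¹`.

Otherwise some `q ≠ 0` orthogonal to `K` has `z q ∈ K`. Then `q` is orthogonal to `zⁿ q` for all
`n ≥ 1`, so that `|q|²` has the same moments as a multiple of the nowhere vanishing weight `ρ`. But
`q` vanishes on a set of positive measure. -/
lemma inv_mul_mem_of_shift_invariant {X : Type*} [MeasurableSpace X] [StandardBorelSpace X]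
    {μ : Measure X} {T : ℝ} [Fact (0 < T)] {θ : X → AddCircle T} (hθ : Measurable θ)
    {s : Set X} (hs : MeasurableSet s) (hμs : μ sᶜ = 0) (hinj : InjOn θ s)
    {ρ : X → ℂ} (hρ : Integrable ρ μ) (hρ0 : ∀ x, ρ x ≠ 0)
    (hρn : ∀ n : ℤ, n ≠ 0 → ∫ x, ρ x * fourier n (θ x) ∂μ = 0)
    {K : Submodule ℂ (Lp ℂ 2 μ)} (hK : IsClosed (K : Set (Lp ℂ 2 μ)))
    (hinv : ∀ f ∈ K, ∀ g : Lp ℂ 2 μ, (g =ᵐ[μ] fun x => fourier 1 (θ x) * f x) → g ∈ K)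
    {E : Set X} (hE : μ E ≠ 0) (hKE : ∀ f ∈ K, ∀ᵐ x ∂μ, x ∈ E → f x = 0)
    {f : Lp ℂ 2 μ} (hf : f ∈ K) {g : Lp ℂ 2 μ}
    (hg : g =ᵐ[μ] fun x => fourier (-1) (θ x) * f x) : g ∈ K := by
  have : CompleteSpace K := hK.completeSpace_coe
  have hmeas : ∀ n : ℤ, AEStronglyMeasurable (fun x => (fourier n (θ x) : ℂ)) μ := fun n =>
    ((fourier n).continuous.measurable.comp hθ).aestronglyMeasurable
  have hbd : ∀ (n : ℤ) (x : X), ‖(fourier n (θ x) : ℂ)‖ ≤ 1 := fun n x => by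
    rw [fourier_apply]; exact (Circle.norm_coe _).le
  set q : Lp ℂ 2 μ := g - K.starProjection g with hq
  have hqK : ∀ w ∈ K, inner ℂ q w = 0 := fun w hw => K.starProjection_inner_eq_zero g w hw
  have hz : ∀ x, (fourier 1 (θ x) : ℂ) * fourier (-1) (θ x) = 1 := fun x => by
    rw [← fourier_add, add_neg_cancel, fourier_zero]
  -- All `zⁿ q` with `n ≥ 1` lie in `K`.
  have hr : ∀ n : ℕ, ∃ r ∈ K, r =ᵐ[μ] fun x => fourier ((n : ℤ) + 1) (θ x) * q x := by
    intro n
    induction n with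
    | zero =>
      obtain ⟨p, hp⟩ := exists_Lp_ae_eq_mul (hmeas 1) (hbd 1) (K.starProjection g)
      refine ⟨f - p, K.sub_mem hf (hinv _ (K.starProjection_apply_mem g) _ hp), ?_⟩
      filter_upwards [Lp.coeFn_sub f p, Lp.coeFn_sub g (K.starProjection g), hp, hg]
        with x h1 h2 h3 h4
      rw [h1, hq, h2, Pi.sub_apply, Pi.sub_apply, h3, h4]
      push_cast
      rw [mul_sub, ← mul_assoc, hz, one_mul]
    | succ n ih =>
      obtain ⟨r, hrK, hr⟩ := ih
      obtain ⟨p, hp⟩ := exists_Lp_ae_eq_mul (hmeas 1) (hbd 1) r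
      refine ⟨p, hinv _ hrK _ hp, ?_⟩
      filter_upwards [hr, hp] with x h1 h2
      rw [h2, h1, ← mul_assoc, ← fourier_add]
      congr 3; push_cast; ring
  set ψ : X → ℂ := fun x => q x * (starRingEnd ℂ) (q x) with hψdef
  have hψ : Integrable ψ μ := L2.integrable_inner (𝕜 := ℂ) q q
  have hpos : ∀ n : ℕ, ∫ x, ψ x * fourier ((n : ℤ) + 1) (θ x) ∂μ = 0 := by
    intro n
    obtain ⟨r, hrK, hr⟩ := hr n
    rw [← hqK r hrK, L2.inner_def]
    refine integral_congr_ae ?_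
    filter_upwards [hr] with x h1
    rw [h1, RCLike.inner_apply, hψdef]
    ring
  have hψn : ∀ n : ℤ, n ≠ 0 → ∫ x, ψ x * fourier n (θ x) ∂μ = 0 := by
    intro n hn
    rcases lt_or_gt_of_ne hn with h | h
    · obtain ⟨k, hk⟩ := Int.eq_ofNat_of_zero_le (show 0 ≤ -n - 1 by omega)
      have h1 := congrArg (starRingEnd ℂ) (hpos k)
      rw [← integral_conj, map_zero] at h1
      rw [← h1]
      congr 1; ext x
      rw [hψdef, map_mul, map_mul, Complex.conj_conj, ← fourier_neg,
        mul_comm ((starRingEnd ℂ) (q x))]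
      congr 3; omega
    · obtain ⟨k, hk⟩ := Int.eq_ofNat_of_zero_le (show 0 ≤ n - 1 by omega)
      rw [← hpos k]
      congr; ext x
      congr 3; omega
  set N : ℂ := ∫ x, ψ x ∂μ with hN
  set R : ℂ := ∫ x, ρ x ∂μ with hR
  have hint : ∀ (ψ : X → ℂ), Integrable ψ μ → ∀ n : ℤ,
      Integrable (fun x => ψ x * fourier n (θ x)) μ := fun ψ hψ n =>
    hψ.mul_bdd (c := 1) (hmeas n) (ae_of_all _ (hbd n))
  -- The combination is chosen so that the moment of order `0` cancels as well.
  have hzero : (fun x => R * ψ x - N * ρ x) =ᵐ[μ] 0 := by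
    refine ae_eq_zero_of_moments_eq_zero hθ hs hμs hinj
      ((hψ.const_mul R).sub (hρ.const_mul N)) fun n => ?_
    have : ∀ x, (R * ψ x - N * ρ x) * fourier n (θ x)
        = R * (ψ x * fourier n (θ x)) - N * (ρ x * fourier n (θ x)) := fun x => by ring
    simp_rw [this]
    rw [integral_sub ((hint _ hψ n).const_mul R) ((hint _ hρ n).const_mul N),
      integral_const_mul, integral_const_mul]
    rcases eq_or_ne n 0 with rfl | hn
    · simp only [fourier_zero, mul_one, ← hN, ← hR]; ring
    · rw [hψn n hn, hρn n hn]; ring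
  have hN0 : N = 0 := by
    by_contra hN0
    obtain ⟨r, hrK, hr⟩ := hr 0
    refine hE (measure_mono_null (t := {x | ¬ (x ∉ E)}) (fun x hx => by simpa using hx)
      (ae_iff.1 ?_))
    filter_upwards [hzero, hKE r hrK, hr] with x h1 h2 h3 hxE
    have hqx : q x = 0 := by
      have := h3.symm.trans (h2 hxE)
      refine (mul_eq_zero.1 this).resolve_left ?_
      rw [fourier_apply]; exact Circle.coe_ne_zero _
    simp only [hψdef, hqx, zero_mul, mul_zero, zero_sub, Pi.zero_apply, neg_eq_zero,
      mul_eq_zero] at h1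
    exact h1.elim hN0 (hρ0 x)
  have hq0 : q = 0 := by
    rw [← inner_self_eq_zero (𝕜 := ℂ), L2.inner_def, ← hN0]
    rfl
  rw [sub_eq_zero.1 (hq.symm.trans hq0)]
  exact K.starProjection_apply_mem g

/-- A closed shift-invariant subspace of `L²` all of whose elements vanish on one set of positive
measure is a module over all multipliers: by `inv_mul_mem_of_shift_invariant` it contains `zⁿ f` for
all `n ∈ ℤ` with `f`, so `conj h * f` has vanishing moments for every `h` orthogonal to it. -/
theorem mul_mem_of_shift_invariant {X : Type*} [MeasurableSpace X] [StandardBorelSpace X]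
    {μ : Measure X} {T : ℝ} [Fact (0 < T)] {θ : X → AddCircle T} (hθ : Measurable θ)
    {s : Set X} (hs : MeasurableSet s) (hμs : μ sᶜ = 0) (hinj : InjOn θ s)
    {ρ : X → ℂ} (hρ : Integrable ρ μ) (hρ0 : ∀ x, ρ x ≠ 0)
    (hρn : ∀ n : ℤ, n ≠ 0 → ∫ x, ρ x * fourier n (θ x) ∂μ = 0)
    {K : Submodule ℂ (Lp ℂ 2 μ)} (hK : IsClosed (K : Set (Lp ℂ 2 μ)))
    (hinv : ∀ f ∈ K, ∀ g : Lp ℂ 2 μ, (g =ᵐ[μ] fun x => fourier 1 (θ x) * f x) → g ∈ K)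
    {E : Set X} (hE : μ E ≠ 0) (hKE : ∀ f ∈ K, ∀ᵐ x ∂μ, x ∈ E → f x = 0)
    {f : Lp ℂ 2 μ} (hf : f ∈ K) {u : X → ℂ} {g : Lp ℂ 2 μ}
    (hg : g =ᵐ[μ] fun x => u x * f x) : g ∈ K := by
  have : CompleteSpace K := hK.completeSpace_coe
  have hmeas : ∀ n : ℤ, AEStronglyMeasurable (fun x => (fourier n (θ x) : ℂ)) μ := fun n =>
    ((fourier n).continuous.measurable.comp hθ).aestronglyMeasurable
  have hbd : ∀ (n : ℤ) (x : X), ‖(fourier n (θ x) : ℂ)‖ ≤ 1 := fun n x => by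
    rw [fourier_apply]; exact (Circle.norm_coe _).le
  have hall : ∀ n : ℤ, ∃ r ∈ K, r =ᵐ[μ] fun x => fourier n (θ x) * f x := by
    intro n
    induction n using Int.induction_on with
    | zero => exact ⟨f, hf, by simp⟩
    | succ n ih =>
      obtain ⟨r, hrK, hr⟩ := ih
      obtain ⟨p, hp⟩ := exists_Lp_ae_eq_mul (hmeas 1) (hbd 1) r
      refine ⟨p, hinv _ hrK _ hp, ?_⟩
      filter_upwards [hr, hp] with x h1 h2
      rw [h2, h1, ← mul_assoc, ← fourier_add, add_comm]
    | pred n ih =>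
      obtain ⟨r, hrK, hr⟩ := ih
      obtain ⟨p, hp⟩ := exists_Lp_ae_eq_mul (hmeas (-1)) (hbd (-1)) r
      refine ⟨p, inv_mul_mem_of_shift_invariant hθ hs hμs hinj hρ hρ0 hρn hK hinv hE hKE hrK hp, ?_⟩
      filter_upwards [hr, hp] with x h1 h2
      rw [h2, h1, ← mul_assoc, ← fourier_add]
      congr 3; ring
  rw [← K.orthogonal_orthogonal, Submodule.mem_orthogonal]
  intro h hh
  have hzero : (fun x => f x * (starRingEnd ℂ) (h x)) =ᵐ[μ] 0 := by
    refine ae_eq_zero_of_moments_eq_zero hθ hs hμs hinj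
      (L2.integrable_inner (𝕜 := ℂ) h f) fun n => ?_
    obtain ⟨r, hrK, hr⟩ := hall n
    rw [← (Submodule.mem_orthogonal' K h).1 hh r hrK, L2.inner_def]
    refine integral_congr_ae ?_
    filter_upwards [hr] with x h1
    rw [h1, RCLike.inner_apply]
    ring
  rw [L2.inner_def]
  refine integral_eq_zero_of_ae ?_
  filter_upwards [hzero, hg] with x h1 h2
  rw [h2, RCLike.inner_apply, mul_assoc, h1, Pi.zero_apply, mul_zero]

/-! ### The Fourier transform on `L²(ℝ)` -/

lemma ae_eq_of_integral_test_mul_eq {F G : ℝ → ℂ} (hF : LocallyIntegrable F)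
    (hG : LocallyIntegrable G)
    (h : ∀ φ : ℝ → ℂ, ContDiff ℝ (↑(⊤ : ℕ∞)) φ → HasCompactSupport φ →
      ∫ x, φ x * F x = ∫ x, φ x * G x) : F =ᵐ[volume] G := by
  refine ae_eq_of_integral_contDiff_smul_eq hF hG fun g hg hgs => ?_
  have := h (fun x => (g x : ℂ)) (Complex.ofRealCLM.contDiff.comp hg)
    (hgs.comp_left (g := fun r : ℝ => (r : ℂ)) Complex.ofReal_zero)
  simpa using this

lemma Lp_locallyIntegrable (f : Lp ℂ 2 (volume : Measure ℝ)) : LocallyIntegrable f :=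
  (Lp.memLp f).locallyIntegrable (by norm_num)

/-- The `L²` Fourier transform is dual to the Fourier integral of test functions. -/
lemma integral_test_mul_fourier (f : Lp ℂ 2 (volume : Measure ℝ)) {φ : ℝ → ℂ}
    (hφ : ContDiff ℝ (↑(⊤ : ℕ∞)) φ) (hφs : HasCompactSupport φ) :
    ∫ x, φ x * (𝓕 f : Lp ℂ 2 (volume : Measure ℝ)) x = ∫ x, 𝓕 φ x * f x := by
  have h := congrArg (fun u : TemperedDistribution ℝ ℂ => u (hφs.toSchwartzMap hφ))
    (Lp.fourier_toTemperedDistribution_eq f)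
  simp only [TemperedDistribution.fourier_apply, Lp.toTemperedDistribution_apply, smul_eq_mul,
    SchwartzMap.fourier_coe] at h
  exact h.symm

lemma integral_test_mul_fourierInv (f : Lp ℂ 2 (volume : Measure ℝ)) {φ : ℝ → ℂ}
    (hφ : ContDiff ℝ (↑(⊤ : ℕ∞)) φ) (hφs : HasCompactSupport φ) :
    ∫ x, φ x * (𝓕⁻ f : Lp ℂ 2 (volume : Measure ℝ)) x = ∫ x, 𝓕⁻ φ x * f x := by
  have h := congrArg (fun u : TemperedDistribution ℝ ℂ => u (hφs.toSchwartzMap hφ))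
    (Lp.fourierInv_toTemperedDistribution_eq f)
  simp only [TemperedDistribution.fourierInv_apply, Lp.toTemperedDistribution_apply, smul_eq_mul,
    SchwartzMap.fourierInv_coe] at h
  exact h.symm

lemma Lp_fourierInv_ae_eq_fourier_neg (f : Lp ℂ 2 (volume : Measure ℝ)) :
    (𝓕⁻ f : Lp ℂ 2 (volume : Measure ℝ)) =ᵐ[volume]
      fun x => (𝓕 f : Lp ℂ 2 (volume : Measure ℝ)) (-x) := by
  refine ae_eq_of_integral_test_mul_eq (Lp_locallyIntegrable _)
    (((Lp.memLp (𝓕 f : Lp ℂ 2 (volume : Measure ℝ))).comp_measurePreserving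
      (Measure.measurePreserving_neg volume)).locallyIntegrable (by norm_num)) fun φ hφ hφs => ?_
  have hφ' : ContDiff ℝ (↑(⊤ : ℕ∞)) fun x => φ (-x) := hφ.comp contDiff_neg
  have hφs' : HasCompactSupport fun x => φ (-x) := hφs.comp_homeomorph (Homeomorph.neg ℝ)
  rw [integral_test_mul_fourierInv f hφ hφs, Real.fourierInv_eq_fourier_comp_neg,
    ← integral_test_mul_fourier f hφ' hφs',
    ← integral_neg_eq_self]
  simp

/-- Modulation becomes translation under the `L²` Fourier transform. -/
lemma Lp_fourier_modulation_ae_eq {f g : Lp ℂ 2 (volume : Measure ℝ)} {β : ℝ}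
    (hg : g =ᵐ[volume] fun x => Complex.exp (2 * Real.pi * β * x * Complex.I) * f x) :
    (𝓕 g : Lp ℂ 2 (volume : Measure ℝ)) =ᵐ[volume]
      fun x => (𝓕 f : Lp ℂ 2 (volume : Measure ℝ)) (x - β) := by
  refine ae_eq_of_integral_test_mul_eq (Lp_locallyIntegrable _)
    (((Lp.memLp (𝓕 f : Lp ℂ 2 (volume : Measure ℝ))).comp_measurePreserving
      (measurePreserving_sub_right volume β)).locallyIntegrable (by norm_num)) fun φ hφ hφs => ?_
  have hφ' : ContDiff ℝ (↑(⊤ : ℕ∞)) fun x => φ (x + β) := hφ.comp (contDiff_id.add contDiff_const)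
  have hφs' : HasCompactSupport fun x => φ (x + β) :=
    hφs.comp_homeomorph (Homeomorph.addRight β)
  have h1 : ∫ x, φ x * (𝓕 f : Lp ℂ 2 (volume : Measure ℝ)) (x - β)
      = ∫ x, φ (x + β) * (𝓕 f : Lp ℂ 2 (volume : Measure ℝ)) x := by
    rw [← integral_add_right_eq_self _ β]
    simp
  rw [h1, integral_test_mul_fourier g hφ hφs, integral_test_mul_fourier f hφ' hφs']
  refine integral_congr_ae ?_
  filter_upwards [hg] with x hx
  rw [hx, ← mul_assoc]
  congr 1
  rw [Real.fourier_real_eq_integral_exp_smul, Real.fourier_real_eq_integral_exp_smul,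
    ← integral_mul_const,
    ← integral_add_right_eq_self _ β]
  congr 1; ext v
  simp only [smul_eq_mul]
  rw [mul_right_comm, ← Complex.exp_add]
  congr 2
  push_cast; ring

lemma continuous_fourierInv_of_integrable {f : ℝ → ℂ} (hf : Integrable f) :
    Continuous (𝓕⁻ f) := by
  rw [Real.fourierInv_eq_fourier_comp_neg]
  exact VectorFourier.fourierIntegral_continuous Real.continuous_fourierChar (by fun_prop)
    hf.comp_neg

/-- For integrable `L²` functions the inverse `L²` Fourier transform is given by the integral. -/
lemma Lp_fourierInv_ae_eq_integral {f : Lp ℂ 2 (volume : Measure ℝ)} (hf : Integrable f) :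
    (𝓕⁻ f : Lp ℂ 2 (volume : Measure ℝ)) =ᵐ[volume] 𝓕⁻ (f : ℝ → ℂ) := by
  refine ae_eq_of_integral_test_mul_eq (Lp_locallyIntegrable _)
    (continuous_fourierInv_of_integrable hf).locallyIntegrable fun φ hφ hφs => ?_
  rw [integral_test_mul_fourierInv f hφ hφs]
  have hφi : Integrable φ := hφ.continuous.integrable_of_hasCompactSupport hφs
  have h := VectorFourier.integral_bilin_fourierIntegral_eq_flip (μ := volume) (ν := volume)
    (L := -(innerₗ ℝ)) (ContinuousLinearMap.mul ℂ ℂ) Real.continuous_fourierChar (by fun_prop) hφi hf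
  have hflip : (-(innerₗ ℝ)).flip = -(innerₗ ℝ) := by
    ext; simp
  rw [hflip] at h
  exact h

/-! ### The Cayley transform and half-line uniqueness -/

/-- The Cayley transform `x ↦ (1 + iσx) / (1 - iσx)` of the real line to the unit circle. -/
noncomputable def cayley (σ : ℝ) (x : ℝ) : ℂ :=
  (1 + σ * x * Complex.I) / (1 - σ * x * Complex.I)

lemma one_sub_mul_I_ne_zero (y : ℝ) : (1 : ℂ) - y * Complex.I ≠ 0 := fun h => by
  simpa using congrArg Complex.re h

lemma one_add_mul_I_ne_zero (y : ℝ) : (1 : ℂ) + y * Complex.I ≠ 0 := fun h => by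
  simpa using congrArg Complex.re h

lemma one_sub_mul_mul_I_ne_zero (σ x : ℝ) : (1 : ℂ) - σ * x * Complex.I ≠ 0 := by
  simpa using one_sub_mul_I_ne_zero (σ * x)

lemma one_add_mul_mul_I_ne_zero (σ x : ℝ) : (1 : ℂ) + σ * x * Complex.I ≠ 0 := by
  simpa using one_add_mul_I_ne_zero (σ * x)

lemma cayley_ne_zero (σ x : ℝ) : cayley σ x ≠ 0 :=
  div_ne_zero (one_add_mul_mul_I_ne_zero σ x) (one_sub_mul_mul_I_ne_zero σ x)

lemma norm_cayley (σ x : ℝ) : ‖cayley σ x‖ = 1 := by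
  have h : (1 : ℂ) + σ * x * Complex.I = (starRingEnd ℂ) (1 - σ * x * Complex.I) := by
    simp
  rw [cayley, h, norm_div, Complex.norm_conj, div_self]
  exact norm_ne_zero_iff.2 (one_sub_mul_mul_I_ne_zero σ x)

lemma continuous_cayley (σ : ℝ) : Continuous (cayley σ) := by
  unfold cayley
  exact Continuous.div (by fun_prop) (by fun_prop) (one_sub_mul_mul_I_ne_zero σ)

lemma cayley_injective {σ : ℝ} (hσ : σ ≠ 0) : Function.Injective (cayley σ) := by
  intro x y h
  rw [cayley, cayley, div_eq_div_iff (one_sub_mul_mul_I_ne_zero σ x)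
    (one_sub_mul_mul_I_ne_zero σ y)] at h
  have h2 : (2 * σ * Complex.I) * x = (2 * σ * Complex.I) * y := by linear_combination h
  have hne : (2 * σ * Complex.I : ℂ) ≠ 0 := by simp [hσ]
  exact_mod_cast mul_left_cancel₀ hne h2

/-- The Cayley transform, as a coordinate on the additive circle of length `1`. -/
noncomputable def cayleyAddCircle (σ : ℝ) (x : ℝ) : AddCircle (1 : ℝ) :=
  (AddCircle.homeomorphCircle one_ne_zero).symm
    ⟨cayley σ x, mem_sphere_zero_iff_norm.2 (norm_cayley σ x)⟩

lemma continuous_cayleyAddCircle (σ : ℝ) : Continuous (cayleyAddCircle σ) :=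
  (Homeomorph.continuous _).comp ((continuous_cayley σ).subtype_mk _)

lemma cayleyAddCircle_injective {σ : ℝ} (hσ : σ ≠ 0) : Function.Injective (cayleyAddCircle σ) :=
  fun _ _ h => cayley_injective hσ (congrArg Subtype.val ((Homeomorph.injective _) h))

lemma fourier_cayleyAddCircle (σ x : ℝ) (n : ℤ) :
    (fourier n (cayleyAddCircle σ x) : ℂ) = cayley σ x ^ n := by
  rw [fourier_apply, AddCircle.toCircle_zsmul, Circle.coe_zpow]
  congr 1
  rw [← AddCircle.homeomorphCircle_apply one_ne_zero]
  exact congrArg Subtype.val (Homeomorph.apply_symm_apply _ _)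

lemma tendsto_cayley {σ : ℝ} (hσ : σ ≠ 0) :
    Filter.Tendsto (cayley σ) (Filter.cocompact ℝ) (nhds (-1)) := by
  have h1 : ∀ x, cayley σ x = -1 + 2 * (1 - σ * x * Complex.I)⁻¹ := fun x => by
    have := one_sub_mul_mul_I_ne_zero σ x
    rw [cayley]; field_simp; ring
  have h2 : Filter.Tendsto (fun x : ℝ => (1 - σ * x * Complex.I : ℂ)⁻¹) (Filter.cocompact ℝ)
      (nhds 0) := by
    refine Filter.tendsto_inv₀_cobounded.comp ?_
    rw [← tendsto_norm_atTop_iff_cobounded]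
    have h3 : Filter.Tendsto (fun x : ℝ => |σ| * ‖x‖) (Filter.cocompact ℝ) Filter.atTop :=
      tendsto_norm_cocompact_atTop.const_mul_atTop (abs_pos.2 hσ)
    refine Filter.tendsto_atTop_mono (fun x => ?_) h3
    have := Complex.abs_im_le_norm (1 - σ * x * Complex.I)
    simpa [abs_mul] using this
  have h4 := (h2.const_mul 2).const_add (-1 : ℂ)
  simp only [mul_zero, add_zero] at h4
  exact h4.congr fun x => (h1 x).symm

lemma hasDerivAt_cayley (σ x : ℝ) :
    HasDerivAt (cayley σ) (2 * σ * Complex.I * (1 + (σ * x) ^ 2 : ℂ)⁻¹ * cayley σ x) x := by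
  have hx : HasDerivAt (fun x : ℝ => (σ * x * Complex.I : ℂ)) (σ * Complex.I) x := by
    simpa using ((hasDerivAt_id x).ofReal_comp.const_mul (σ : ℂ)).mul_const Complex.I
  have h1 := one_sub_mul_mul_I_ne_zero σ x
  have h2 := one_add_mul_mul_I_ne_zero σ x
  have h3 : (1 + (σ * x) ^ 2 : ℂ) = (1 + σ * x * Complex.I) * (1 - σ * x * Complex.I) := by
    linear_combination ((σ * x : ℂ) ^ 2) * Complex.I_sq
  convert! (hx.const_add 1).div (hx.const_sub 1) h1 using 1
  rw [h3, cayley]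
  have hab : (1 + σ * x * Complex.I : ℂ) + (1 - σ * x * Complex.I) = 2 := by ring
  generalize (1 + σ * x * Complex.I : ℂ) = a at *
  generalize (1 - σ * x * Complex.I : ℂ) = b at *
  field_simp
  linear_combination -σ * hab

lemma integrable_inv_one_add_mul_sq {σ : ℝ} (hσ : σ ≠ 0) :
    Integrable (fun x : ℝ => (1 + (σ * x) ^ 2 : ℂ)⁻¹) := by
  have := (integrable_inv_one_add_sq.comp_mul_left' hσ).ofReal (𝕜 := ℂ)
  simpa using this

/-- The weight `1 / (1 + (σx)²)` is, up to a constant, the pullback of arc length by the Cayley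
transform, so that its nontrivial moments vanish. -/
lemma integral_inv_one_add_mul_sq_mul_cayley_zpow {σ : ℝ} (hσ : σ ≠ 0) {n : ℤ} (hn : n ≠ 0) :
    ∫ x : ℝ, (1 + (σ * x) ^ 2 : ℂ)⁻¹ * cayley σ x ^ n = 0 := by
  have hder : ∀ x : ℝ, HasDerivAt (fun x => cayley σ x ^ n)
      (2 * σ * Complex.I * n * ((1 + (σ * x) ^ 2 : ℂ)⁻¹ * cayley σ x ^ n)) x := fun x => by
    convert! (hasDerivAt_zpow n _ (Or.inl (cayley_ne_zero σ x))).scomp x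
      (hasDerivAt_cayley σ x) using 1
    have : cayley σ x ^ n = cayley σ x ^ (n - 1) * cayley σ x := by
      rw [← zpow_add_one₀ (cayley_ne_zero σ x), sub_add_cancel]
    rw [this, smul_eq_mul]; ring
  have hint : Integrable fun x : ℝ => (1 + (σ * x) ^ 2 : ℂ)⁻¹ * cayley σ x ^ n :=
    (integrable_inv_one_add_mul_sq hσ).mul_bdd (c := 1)
      ((continuous_cayley σ).zpow₀ n
        fun x => Or.inl (cayley_ne_zero σ x)).aestronglyMeasurable
      (ae_of_all _ fun x => by rw [norm_zpow, norm_cayley, one_zpow])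
  have hlim : Filter.Tendsto (fun x => cayley σ x ^ n) (Filter.cocompact ℝ) (nhds ((-1) ^ n)) :=
    (tendsto_cayley hσ).zpow₀ n (Or.inl (by simp))
  have h := integral_of_hasDerivAt_of_tendsto hder (hint.const_mul _)
    (hlim.mono_left atBot_le_cocompact) (hlim.mono_left atTop_le_cocompact)
  rw [integral_const_mul, sub_self, mul_eq_zero] at h
  refine h.resolve_left ?_
  simp [hσ, hn]

/-- The Cayley transform is an average of the characters `exp(iσbx)` with `b ≥ 0`. -/
lemma cayley_eq_integral (σ x : ℝ) :
    cayley σ x = 2 * (∫ b in Ioi (0 : ℝ), Real.exp (-b) * Complex.exp (σ * b * x * Complex.I))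
      - 1 := by
  have h := integral_exp_mul_complex_Ioi (a := -(1 - σ * x * Complex.I)) (by simp) 0
  have h2 : ∫ b in Ioi (0 : ℝ), Real.exp (-b) * Complex.exp (σ * b * x * Complex.I)
      = ∫ b in Ioi (0 : ℝ), Complex.exp (-(1 - σ * x * Complex.I) * b) := by
    congr 1; ext b
    rw [Complex.ofReal_exp, ← Complex.exp_add]
    congr 1; push_cast; ring
  have := one_sub_mul_mul_I_ne_zero σ x
  rw [h2, h, cayley]
  simp only [Complex.ofReal_zero, mul_zero, Complex.exp_zero]
  rw [neg_div_neg_eq]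
  field_simp
  ring

/-- A closed subspace of `L²(ℝ)` invariant under the characters `exp(iσbx)` with `b ≥ 0` is
invariant under their average, the Cayley transform. -/
lemma cayley_mul_mem {σ : ℝ} {K : Submodule ℂ (Lp ℂ 2 (volume : Measure ℝ))}
    (hK : IsClosed (K : Set (Lp ℂ 2 (volume : Measure ℝ))))
    (hinv : ∀ b : ℝ, 0 ≤ b → ∀ f ∈ K, ∀ g : Lp ℂ 2 (volume : Measure ℝ),
      (g =ᵐ[volume] fun x => Complex.exp (σ * b * x * Complex.I) * f x) → g ∈ K)
    {f g : Lp ℂ 2 (volume : Measure ℝ)} (hf : f ∈ K)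
    (hg : g =ᵐ[volume] fun x => cayley σ x * f x) : g ∈ K := by
  have : CompleteSpace K := hK.completeSpace_coe
  rw [← K.orthogonal_orthogonal, Submodule.mem_orthogonal]
  intro h hh
  have hexp : ∀ t : ℝ, ‖Complex.exp (t * Complex.I)‖ = 1 := Complex.norm_exp_ofReal_mul_I
  have hnorm : ∀ b x : ℝ, ‖Complex.exp (σ * b * x * Complex.I)‖ = 1 := fun b x => by
    simpa using hexp (σ * b * x)
  set p : ℝ → ℂ := fun x => f x * (starRingEnd ℂ) (h x) with hp
  have hpi : Integrable p := L2.integrable_inner (𝕜 := ℂ) h f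
  have hzero : ∀ b : ℝ, 0 ≤ b → ∫ x : ℝ, Complex.exp (σ * b * x * Complex.I) * p x = 0 := by
    intro b hb
    obtain ⟨r, hr⟩ := exists_Lp_ae_eq_mul (μ := volume)
      (u := fun x : ℝ => Complex.exp (σ * b * x * Complex.I))
      (by fun_prop) (fun x => (hnorm b x).le) f
    rw [← (Submodule.mem_orthogonal' K h).1 hh r (hinv b hb f hf r hr), L2.inner_def]
    refine integral_congr_ae ?_
    filter_upwards [hr] with x h1
    rw [h1, RCLike.inner_apply, hp]
    ring
  have hint : Integrable (fun y : ℝ × ℝ => p y.1 * (Real.exp (-y.2) : ℂ) *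
      Complex.exp (σ * y.2 * y.1 * Complex.I)) (volume.prod (volume.restrict (Ioi 0))) := by
    have he : Integrable (fun b : ℝ => (Real.exp (-b) : ℂ)) (volume.restrict (Ioi 0)) :=
      (integrableOn_exp_neg_Ioi 0).ofReal
    exact (hpi.mul_prod he).mul_bdd (c := 1)
      (Continuous.aestronglyMeasurable (by fun_prop)) (ae_of_all _ fun y => (hnorm _ _).le)
  have hswap : ∫ x : ℝ, p x * (∫ b in Ioi (0 : ℝ),
      Real.exp (-b) * Complex.exp (σ * b * x * Complex.I)) = 0 := by
    calc _ = ∫ x : ℝ, ∫ b in Ioi (0 : ℝ), p x * (Real.exp (-b) : ℂ) *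
          Complex.exp (σ * b * x * Complex.I) := by
          congr 1; ext x
          rw [← integral_const_mul]
          congr 1; ext b; ring
      _ = ∫ b in Ioi (0 : ℝ), ∫ x : ℝ, p x * (Real.exp (-b) : ℂ) *
          Complex.exp (σ * b * x * Complex.I) := integral_integral_swap hint
      _ = ∫ b in Ioi (0 : ℝ), (0 : ℂ) := by
          refine setIntegral_congr_fun measurableSet_Ioi fun b hb => ?_
          rw [← mul_zero (Real.exp (-b) : ℂ), ← hzero b (le_of_lt hb), ← integral_const_mul]
          congr 1; ext x; ring
      _ = 0 := by simp
  have h0 : ∫ x, p x = 0 := by simpa using hzero 0 le_rfl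
  have hpm : Integrable fun x : ℝ => p x * (∫ b in Ioi (0 : ℝ),
      Real.exp (-b) * Complex.exp (σ * b * x * Complex.I)) := by
    have := hint.integral_prod_left
    refine this.congr (ae_of_all _ fun x => ?_)
    simp only
    rw [← integral_const_mul]
    congr 1; ext b; ring
  rw [L2.inner_def]
  calc _ = ∫ x : ℝ, (2 * (p x * (∫ b in Ioi (0 : ℝ),
        Real.exp (-b) * Complex.exp (σ * b * x * Complex.I))) - p x) := by
        refine integral_congr_ae ?_
        filter_upwards [hg] with x hx
        rw [hx, RCLike.inner_apply, cayley_eq_integral, hp]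
        ring
    _ = 0 := by
        rw [integral_sub (hpm.const_mul 2) hpi, integral_const_mul, hswap, h0]
        simp

/-! ### Uniqueness on half-lines and for lacunary samples -/

/-- The closed subspace of `L²` of the functions which vanish almost everywhere on `S`. -/
noncomputable def vanishingOn {X : Type*} [MeasurableSpace X] (μ : Measure X) (S : Set X) :
    Submodule ℂ (Lp ℂ 2 μ) :=
  (LpToLpRestrictCLM X ℂ ℂ μ 2 S).ker

lemma isClosed_vanishingOn {X : Type*} [MeasurableSpace X] (μ : Measure X) (S : Set X) :
    IsClosed (vanishingOn μ S : Set (Lp ℂ 2 μ)) :=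
  (LpToLpRestrictCLM X ℂ ℂ μ 2 S).isClosed_ker

lemma mem_vanishingOn {X : Type*} [MeasurableSpace X] {μ : Measure X} {S : Set X}
    (hS : MeasurableSet S) {f : Lp ℂ 2 μ} :
    f ∈ vanishingOn μ S ↔ ∀ᵐ x ∂μ, x ∈ S → f x = 0 := by
  rw [vanishingOn, LinearMap.mem_ker, Lp.eq_zero_iff_ae_eq_zero, ← ae_restrict_iff' hS]
  have h := LpToLpRestrictCLM_coeFn (F := ℂ) (p := 2) (μ := μ) ℂ S f
  constructor
  · intro h0
    filter_upwards [h, h0] with x h1 h2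
    rw [← h1]; exact h2
  · intro h0
    filter_upwards [h, h0] with x h1 h2
    exact h1.trans h2

/-- If an `L²` function vanishes on a set of positive measure and its Fourier transform vanishes on
a half-line (whose direction is the sign of `σ`), the function is zero. The functions with these two
properties form a closed subspace invariant under `exp(iσbx)` for `b ≥ 0`, hence under every
`exp(iβx)`; so the Fourier transform vanishes on all translates of the half-line. -/
lemma eq_zero_of_fourier_eq_zero_of_mul_lt {σ a : ℝ} (hσ : σ ≠ 0) {E : Set ℝ}
    (hE : MeasurableSet E) (hE0 : volume E ≠ 0) {f : Lp ℂ 2 (volume : Measure ℝ)}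
    (hf : ∀ᵐ ξ : ℝ, σ * ξ < a → (𝓕 f : Lp ℂ 2 (volume : Measure ℝ)) ξ = 0)
    (hfE : ∀ᵐ x : ℝ, x ∈ E → f x = 0) : f = 0 := by
  have : Fact ((0 : ℝ) < 1) := ⟨one_pos⟩
  set J : Set ℝ := {ξ | σ * ξ < a} with hJ
  have hJm : MeasurableSet J := measurableSet_lt (by fun_prop) measurable_const
  set F : Lp ℂ 2 (volume : Measure ℝ) →L[ℂ] Lp ℂ 2 (volume : Measure ℝ) :=
    (Lp.fourierTransformₗᵢ ℝ ℂ : _ ≃ₗᵢ[ℂ] _).toContinuousLinearEquiv.toContinuousLinearMap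
  set K : Submodule ℂ (Lp ℂ 2 (volume : Measure ℝ)) :=
    (vanishingOn volume J).comap F.toLinearMap ⊓ vanishingOn volume E with hK
  have hKc : IsClosed (K : Set (Lp ℂ 2 (volume : Measure ℝ))) :=
    ((isClosed_vanishingOn volume J).preimage F.continuous).inter (isClosed_vanishingOn volume E)
  have hKmem : ∀ g, g ∈ K ↔ (∀ᵐ ξ : ℝ, ξ ∈ J → (𝓕 g : Lp ℂ 2 (volume : Measure ℝ)) ξ = 0) ∧
      ∀ᵐ x : ℝ, x ∈ E → g x = 0 := fun g => by
    rw [hK, Submodule.mem_inf, mem_vanishingOn hE, Submodule.mem_comap, mem_vanishingOn hJm]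
    rfl
  have hinv : ∀ b : ℝ, 0 ≤ b → ∀ f ∈ K, ∀ g : Lp ℂ 2 (volume : Measure ℝ),
      (g =ᵐ[volume] fun x => Complex.exp (σ * b * x * Complex.I) * f x) → g ∈ K := by
    intro b hb f hf g hg
    rw [hKmem] at hf ⊢
    refine ⟨?_, ?_⟩
    · have hg' : g =ᵐ[volume] fun x =>
          Complex.exp (2 * Real.pi * (σ * b / (2 * Real.pi) : ℝ) * x * Complex.I) * f x := by
        refine hg.trans (ae_of_all _ fun x => ?_)
        simp only
        congr 2
        have : (Real.pi : ℂ) ≠ 0 := by exact_mod_cast Real.pi_ne_zero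
        push_cast
        field_simp
      have h1 := (measurePreserving_sub_right volume
        (σ * b / (2 * Real.pi))).quasiMeasurePreserving.ae hf.1
      filter_upwards [Lp_fourier_modulation_ae_eq hg', h1] with ξ h2 h3 hξ
      rw [h2]
      refine h3 ?_
      have h4 : σ * (σ * b / (2 * Real.pi)) = σ ^ 2 * b / (2 * Real.pi) := by ring
      have h5 : 0 ≤ σ ^ 2 * b / (2 * Real.pi) := by positivity
      change σ * (ξ - σ * b / (2 * Real.pi)) < a
      rw [mul_sub, h4]
      have : σ * ξ < a := hξ
      linarith
    · filter_upwards [hg, hf.2] with x h1 h2 hx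
      rw [h1, h2 hx, mul_zero]
  have hall : ∀ n : ℕ, ∀ᵐ ξ : ℝ, σ * ξ - n < a → (𝓕 f : Lp ℂ 2 (volume : Measure ℝ)) ξ = 0 := by
    intro n
    -- Modulation by `β` shifts the spectrum by `β`, so the half-line grows by `n`, against the
    -- direction of the known invariance.
    set β : ℝ := -n / σ with hβ
    obtain ⟨g, hg⟩ := exists_Lp_ae_eq_mul (μ := volume)
      (u := fun x : ℝ => Complex.exp (2 * Real.pi * β * x * Complex.I)) (C := 1)
      (by fun_prop) (fun x => by
        have := Complex.norm_exp_ofReal_mul_I (2 * Real.pi * β * x)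
        push_cast at this
        exact this.le) f
    have hgK : g ∈ K := by
      refine mul_mem_of_shift_invariant (continuous_cayleyAddCircle σ).measurable
        MeasurableSet.univ (by simp) (cayleyAddCircle_injective hσ).injOn
        (integrable_inv_one_add_mul_sq hσ) (fun x => inv_ne_zero ?_) (fun n hn => ?_) hKc ?_ hE0
        (fun g hg => ((hKmem g).1 hg).2) ((hKmem f).2 ⟨hf, hfE⟩) hg
      · have : (0 : ℝ) < 1 + (σ * x) ^ 2 := by positivity
        exact_mod_cast this.ne'
      · simp_rw [fourier_cayleyAddCircle]
        exact integral_inv_one_add_mul_sq_mul_cayley_zpow hσ hn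
      · intro f hf g hg
        simp_rw [fourier_cayleyAddCircle, zpow_one] at hg
        exact cayley_mul_mem hKc hinv hf hg
    have h1 := (measurePreserving_add_right volume β).quasiMeasurePreserving.ae
      ((hKmem g).1 hgK).1
    have h2 := (measurePreserving_add_right volume β).quasiMeasurePreserving.ae
      (Lp_fourier_modulation_ae_eq hg)
    filter_upwards [h1, h2] with ξ h3 h4 hξ
    rw [add_sub_cancel_right] at h4
    rw [← h4]
    refine h3 ?_
    change σ * (ξ + β) < a
    rw [mul_add, hβ, mul_div_cancel₀ _ hσ]
    linarith
  have hzero : (𝓕 f : Lp ℂ 2 (volume : Measure ℝ)) = 0 := by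
    rw [Lp.eq_zero_iff_ae_eq_zero]
    filter_upwards [ae_all_iff.2 hall] with ξ hξ
    obtain ⟨n, hn⟩ := exists_nat_gt (σ * ξ - a)
    exact hξ n (by linarith)
  rw [← norm_eq_zero, ← Lp.norm_fourier_eq, hzero, norm_zero]

/-- An `L²` function which vanishes on a set of positive measure, and whose Fourier transform
vanishes on a half-line, is zero. -/
theorem eq_zero_of_fourier_eq_zero_on_halfLine {B E : Set ℝ}
    (hB : ∃ a : ℝ, Ioi a ⊆ B ∨ Iio a ⊆ B) (hE : MeasurableSet E) (hE0 : volume E ≠ 0)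
    {f : Lp ℂ 2 (volume : Measure ℝ)}
    (hf : ∀ᵐ ξ : ℝ, ξ ∈ B → (𝓕 f : Lp ℂ 2 (volume : Measure ℝ)) ξ = 0)
    (hfE : ∀ᵐ x : ℝ, x ∈ E → f x = 0) : f = 0 := by
  obtain ⟨a, ha | ha⟩ := hB
  · refine eq_zero_of_fourier_eq_zero_of_mul_lt (σ := -1) (a := -a) (by norm_num) hE hE0 ?_ hfE
    filter_upwards [hf] with ξ hξ h
    exact hξ (ha (by simpa using h))
  · refine eq_zero_of_fourier_eq_zero_of_mul_lt (σ := 1) (a := a) one_ne_zero hE hE0 ?_ hfE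
    filter_upwards [hf] with ξ hξ h
    exact hξ (ha (by simpa using h))

/-- An `L²` function which vanishes on a half-line, and whose Fourier transform vanishes on a set of
positive measure, is zero. -/
theorem eq_zero_of_eq_zero_on_halfLine {B E : Set ℝ}
    (hB : ∃ a : ℝ, Ioi a ⊆ B ∨ Iio a ⊆ B) (hE : MeasurableSet E) (hE0 : volume E ≠ 0)
    {f : Lp ℂ 2 (volume : Measure ℝ)} (hf : ∀ᵐ x : ℝ, x ∈ B → f x = 0)
    (hfE : ∀ᵐ ξ : ℝ, ξ ∈ E → (𝓕 f : Lp ℂ 2 (volume : Measure ℝ)) ξ = 0) : f = 0 := by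
  have hB' : ∃ a : ℝ, Ioi a ⊆ Neg.neg ⁻¹' B ∨ Iio a ⊆ Neg.neg ⁻¹' B := by
    obtain ⟨a, ha | ha⟩ := hB
    · exact ⟨-a, Or.inr fun x hx => ha (mem_Ioi.2 (lt_neg.1 hx))⟩
    · exact ⟨-a, Or.inl fun x hx => ha (mem_Iio.2 (neg_lt.1 hx))⟩
  have h := eq_zero_of_fourier_eq_zero_on_halfLine (f := 𝓕 f) hB' hE hE0 ?_ hfE
  · rw [← norm_eq_zero, ← Lp.norm_fourier_eq, h, norm_zero]
  have h1 := Lp_fourierInv_ae_eq_fourier_neg (𝓕 f)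
  rw [FourierTransform.fourierInv_fourier_eq] at h1
  have h2 := (Measure.measurePreserving_neg (volume : Measure ℝ)).quasiMeasurePreserving.ae
    (h1.and hf)
  filter_upwards [h2] with ξ h3 hξ
  rw [neg_neg] at h3
  rw [← h3.1, h3.2 hξ]

lemma integral_Ioc_exp_eq_zero {T : ℝ} (hT : 0 < T) {n : ℤ} (hn : n ≠ 0) :
    ∫ x in Ioc (-(T / 2)) (T / 2), Complex.exp (2 * Real.pi * Complex.I * n * x / T) = 0 := by
  have hTc : (T : ℂ) ≠ 0 := by exact_mod_cast hT.ne'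
  set c : ℂ := 2 * Real.pi * Complex.I * n / T with hc
  have hc0 : c ≠ 0 := by simp [hc, hn, Real.pi_ne_zero, hT.ne']
  have h1 : ∀ x : ℝ, (2 * Real.pi * Complex.I * n * x / T : ℂ) = c * x := fun x => by
    rw [hc]; ring
  simp_rw [h1]
  rw [← intervalIntegral.integral_of_le (by linarith), integral_exp_mul_complex hc0,
    div_eq_zero_iff, sub_eq_zero]
  left
  have h2 : c * ((T / 2 : ℝ) : ℂ) = c * ((-(T / 2) : ℝ) : ℂ) + n * (2 * Real.pi * Complex.I) := by
    rw [hc]; push_cast; field_simp; ring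
  rw [h2, Complex.exp_add, Complex.exp_int_mul_two_pi_mul_I, mul_one]

/-- An `L²` function supported in an interval shorter than `T`, whose Fourier coefficients for the
period `T` vanish for all `k ≤ s`, is zero: as a function on the circle of length `T`, it has
one-sided spectrum and vanishes on an arc. -/
theorem ae_eq_zero_of_fourierCoeff_eq_zero {B T : ℝ} (hB : 0 < B) (hBT : 2 * B < T) (s : ℤ)
    {W : Lp ℂ 2 (volume : Measure ℝ)} (hW : ∀ᵐ ξ : ℝ, ξ ∉ Icc (-B) B → W ξ = 0)
    (hcoeff : ∀ k : ℤ, k ≤ s →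
      ∫ ξ : ℝ, Complex.exp (2 * Real.pi * Complex.I * k * ξ / T) * W ξ = 0) : W = 0 := by
  have hT : 0 < T := by linarith
  have : Fact (0 < T) := ⟨hT⟩
  set S : Set ℝ := Ioc (-(T / 2)) (T / 2) with hS
  set μ : Measure ℝ := volume.restrict S with hμ
  -- The reflection turns the vanishing for `k ≤ s` into vanishing for `-s ≤ n`, which is preserved
  -- by multiplication with the coordinate.
  set θ : ℝ → AddCircle T := fun x => ((-x : ℝ) : AddCircle T) with hθdef
  have hθ : Measurable θ := (AddCircle.measurable_mk').comp measurable_neg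
  have hθinj : InjOn θ S := by
    intro x hx y hy hxy
    have h1 : ((x : ℝ) : AddCircle T) = (y : ℝ) := by
      simp only [hθdef, AddCircle.coe_neg, neg_inj] at hxy
      exact hxy
    have h2 : -(T / 2) + T = T / 2 := by ring
    exact (AddCircle.coe_eq_coe_iff_of_mem_Ioc (p := T) (a := -(T / 2)) (by rwa [h2])
      (by rwa [h2])).1 h1
  have hfou : ∀ (n : ℤ) (x : ℝ), (fourier n (θ x) : ℂ)
      = Complex.exp (2 * Real.pi * Complex.I * ((-n : ℤ) : ℂ) * x / T) := fun n x => by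
    rw [hθdef, fourier_coe_apply]
    congr 1; push_cast; ring
  have hmeas : ∀ n : ℤ, AEStronglyMeasurable (fun x => (fourier n (θ x) : ℂ)) μ := fun n =>
    ((fourier n).continuous.measurable.comp hθ).aestronglyMeasurable
  have hbd : ∀ (n : ℤ) (x : ℝ), ‖(fourier n (θ x) : ℂ)‖ ≤ 1 := fun n x => by
    rw [fourier_apply]; exact (Circle.norm_coe _).le
  have hE : MeasurableSet (Ioc B (T / 2)) := measurableSet_Ioc
  have hE0 : μ (Ioc B (T / 2)) ≠ 0 := by
    rw [hμ, Measure.restrict_apply hE, inter_eq_left.2 (Ioc_subset_Ioc_left (by linarith)),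
      Real.volume_Ioc, ENNReal.ofReal_ne_zero_iff]
    linarith
  let e : ℤ → Lp ℂ 2 μ := fun n => (MemLp.of_bound (hmeas (-n)) 1 (ae_of_all _ (hbd (-n)))).toLp
  have he : ∀ (n : ℤ) (f : Lp ℂ 2 μ), inner ℂ (e n) f = ∫ x, f x * fourier n (θ x) ∂μ := by
    intro n f
    rw [L2.inner_def]
    refine integral_congr_ae ?_
    filter_upwards [(MemLp.of_bound (hmeas (-n)) 1 (ae_of_all _ (hbd (-n)))).coeFn_toLp] with x hx
    rw [RCLike.inner_apply, hx, fourier_neg, Complex.conj_conj]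
  set K : Submodule ℂ (Lp ℂ 2 μ) :=
    (⨅ n : {n : ℤ // -s ≤ n}, (innerSL ℂ (e n)).ker) ⊓ vanishingOn μ (Ioc B (T / 2)) with hK
  have hKc : IsClosed (K : Set (Lp ℂ 2 μ)) := by
    refine IsClosed.inter ?_ (isClosed_vanishingOn _ _)
    rw [Submodule.coe_iInf]
    exact isClosed_iInter fun n => (innerSL ℂ (e n)).isClosed_ker
  have hKmem : ∀ f, f ∈ K ↔ (∀ n : ℤ, -s ≤ n → ∫ x, f x * fourier n (θ x) ∂μ = 0) ∧
      ∀ᵐ x ∂μ, x ∈ Ioc B (T / 2) → f x = 0 := fun f => by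
    rw [hK, Submodule.mem_inf, mem_vanishingOn hE, Submodule.mem_iInf,
      Subtype.forall]
    simp_rw [← he]
    rfl
  have hinv : ∀ f ∈ K, ∀ g : Lp ℂ 2 μ, (g =ᵐ[μ] fun x => fourier 1 (θ x) * f x) → g ∈ K := by
    intro f hf g hg
    rw [hKmem] at hf ⊢
    refine ⟨fun n hn => ?_, ?_⟩
    · rw [← hf.1 (n + 1) (by omega)]
      refine integral_congr_ae ?_
      filter_upwards [hg] with x hx
      rw [hx, fourier_add]; ring
    · filter_upwards [hg, hf.2] with x h1 h2 hx
      rw [h1, h2 hx, mul_zero]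
  have hμS : μ Sᶜ = 0 := by
    rw [hμ, Measure.restrict_apply measurableSet_Ioc.compl,
      compl_inter_self, measure_empty]
  set f : Lp ℂ 2 μ := LpToLpRestrictCLM ℝ ℂ ℂ volume 2 S W with hf
  have hfW : f =ᵐ[μ] W := LpToLpRestrictCLM_coeFn ℂ S W
  have hWS : ∀ᵐ x : ℝ, x ∉ S → W x = 0 := by
    filter_upwards [hW] with x hx hxS
    exact hx fun h => hxS ⟨by linarith [h.1], by linarith [h.2]⟩
  have hfK : f ∈ K := by
    rw [hKmem]
    refine ⟨fun n hn => ?_, ?_⟩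
    · have h1 : ∫ x in S, Complex.exp (2 * Real.pi * Complex.I * ((-n : ℤ) : ℂ) * x / T) * W x
          = 0 := by
        rw [← hcoeff (-n) (by omega)]
        refine setIntegral_eq_integral_of_ae_compl_eq_zero ?_
        filter_upwards [hWS] with x hx hxS
        rw [hx hxS, mul_zero]
      rw [← h1]
      refine integral_congr_ae ?_
      filter_upwards [hfW] with x hx
      rw [hx, hfou, mul_comm]
    · filter_upwards [hfW, ae_restrict_of_ae hW] with x h1 h2 hx
      rw [h1]
      exact h2 fun h => absurd h.2 (not_le.2 hx.1)
  have hf0 : f =ᵐ[μ] 0 := by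
    refine ae_eq_zero_of_moments_eq_zero hθ measurableSet_Ioc hμS hθinj
      ((Lp.memLp f).integrable (by norm_num)) fun n => ?_
    obtain ⟨g, hg⟩ := exists_Lp_ae_eq_mul (hmeas (n + s)) (hbd (n + s)) f
    have hgK : g ∈ K := by
      refine mul_mem_of_shift_invariant (ρ := fun _ => 1) hθ measurableSet_Ioc hμS hθinj
        (integrable_const _) (fun _ => one_ne_zero) (fun n hn => ?_) hKc hinv hE0
        (fun g hg => ((hKmem g).1 hg).2) hfK hg
      simp_rw [one_mul, hfou]
      exact integral_Ioc_exp_eq_zero hT (neg_ne_zero.2 hn)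
    rw [← ((hKmem g).1 hgK).1 (-s) le_rfl]
    refine integral_congr_ae ?_
    filter_upwards [hg] with x hx
    rw [hx, mul_right_comm, ← fourier_add, mul_comm]
    congr 3; ring
  rw [Lp.eq_zero_iff_ae_eq_zero]
  have h1 := (ae_restrict_iff' measurableSet_Ioc).1 (hfW.symm.trans hf0)
  filter_upwards [h1, hWS] with x h2 h3
  by_cases hx : x ∈ S
  · exact h2 hx
  · exact h3 hx

/-! ### Spectrum gaps in angular frequency -/

namespace BranchedProcess

lemma ae_fourier_of_ae_angularFourier {f : L2} {G : Set ℝ}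
    (h : ∀ᵐ ω : ℝ, ω ∈ G → angularFourier f ω = 0) :
    ∀ᵐ ξ : ℝ, ξ ∈ (fun ξ => 2 * Real.pi * ξ) ⁻¹' G → (𝓕 f : L2) ξ = 0 := by
  have hπ : (2 * Real.pi : ℝ) ≠ 0 := by positivity
  have hq : Measure.QuasiMeasurePreserving (fun ξ : ℝ => 2 * Real.pi * ξ) volume volume := by
    refine ⟨by fun_prop, ?_⟩
    rw [Real.map_volume_mul_left hπ]
    exact Measure.smul_absolutelyContinuous
  filter_upwards [hq.ae h] with ξ h1 h2
  have h3 := h1 h2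
  rwa [angularFourier, mul_div_cancel_left₀ _ hπ] at h3

lemma angularFourier_sub_ae_eq_zero {f g : L2} {G : Set ℝ}
    (hf : ∀ᵐ ω : ℝ, ω ∈ G → angularFourier f ω = 0)
    (hg : ∀ᵐ ω : ℝ, ω ∈ G → angularFourier g ω = 0) :
    ∀ᵐ ω : ℝ, ω ∈ G → angularFourier (f - g) ω = 0 := by
  have hπ : (2 * Real.pi : ℝ)⁻¹ ≠ 0 := by positivity
  have hq : Measure.QuasiMeasurePreserving (fun ω : ℝ => (2 * Real.pi)⁻¹ * ω) volume volume := by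
    refine ⟨by fun_prop, ?_⟩
    rw [Real.map_volume_mul_left hπ]
    exact Measure.smul_absolutelyContinuous
  have hsub : (𝓕 (f - g) : L2) = 𝓕 f - 𝓕 g := (Lp.fourierTransformₗᵢ ℝ ℂ).map_sub f g
  filter_upwards [hf, hg, hq.ae (Lp.coeFn_sub (𝓕 f : L2) (𝓕 g : L2))] with ω h1 h2 h3 hω
  have h4 := h1 hω
  have h5 := h2 hω
  rw [angularFourier, div_eq_inv_mul] at h4 h5 ⊢
  rw [hsub, h3, Pi.sub_apply, h4, h5, sub_zero]

lemma measurableSet_of_mem_admissibleSets {B : Set ℝ} (hB : B ∈ admissibleSets) :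
    MeasurableSet B :=
  hB.elim (fun h => h.1) (fun h => h.1)

lemma volume_ne_zero_of_mem_admissibleSets {B : Set ℝ} (hB : B ∈ admissibleSets) :
    volume B ≠ 0 := by
  rcases hB with h | ⟨-, a, h | h⟩
  · exact h.2.1.ne'
  · exact fun h0 => by simpa using (measure_mono h).trans_eq h0
  · exact fun h0 => by simpa using (measure_mono h).trans_eq h0

lemma exists_halfLine_of_volume_eq_top {B : Set ℝ} (hB : B ∈ admissibleSets)
    (h : volume B = ⊤) : ∃ a : ℝ, Ioi a ⊆ B ∨ Iio a ⊆ B :=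
  hB.elim (fun hf => absurd h hf.2.2.ne) (fun hi => hi.2)

/-- Two `L₂` functions which agree on `I` and have a common spectrum gap `G` are equal if `I ∪ G` has
infinite measure: then one of `I`, `G` contains a half-line. -/
theorem eq_of_ae_eq_on_of_gap {I G : Set ℝ} (hI : I ∈ admissibleSets) (hG : G ∈ admissibleSets)
    (hIG : volume (I ∪ G) = ⊤) {f g : L2} (hfg : ∀ᵐ t : ℝ, t ∈ I → f t = g t)
    (hf : ∀ᵐ ω : ℝ, ω ∈ G → angularFourier f ω = 0)
    (hg : ∀ᵐ ω : ℝ, ω ∈ G → angularFourier g ω = 0) : f = g := by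
  have hπ : (0 : ℝ) < 2 * Real.pi := by positivity
  have h1 : ∀ᵐ t : ℝ, t ∈ I → (f - g : L2) t = 0 := by
    filter_upwards [hfg, Lp.coeFn_sub f g] with t h1 h2 ht
    rw [h2, Pi.sub_apply, h1 ht, sub_self]
  have h2 := ae_fourier_of_ae_angularFourier (angularFourier_sub_ae_eq_zero hf hg)
  rw [← sub_eq_zero]
  by_cases hItop : volume I = ⊤
  · refine eq_zero_of_eq_zero_on_halfLine (exists_halfLine_of_volume_eq_top hI hItop)
      ((measurableSet_of_mem_admissibleSets hG).preimage (by fun_prop)) ?_ h1 h2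
    rw [Real.volume_preimage_mul_left hπ.ne']
    exact mul_ne_zero (by simp) (volume_ne_zero_of_mem_admissibleSets hG)
  · have hGtop : volume G = ⊤ := by
      by_contra hne
      exact (measure_union_lt_top (lt_top_iff_ne_top.2 hItop) (lt_top_iff_ne_top.2 hne)).ne hIG
    refine eq_zero_of_fourier_eq_zero_on_halfLine ?_ (measurableSet_of_mem_admissibleSets hI)
      (volume_ne_zero_of_mem_admissibleSets hI) h2 h1
    obtain ⟨a, ha | ha⟩ := exists_halfLine_of_volume_eq_top hG hGtop
    · exact ⟨a / (2 * Real.pi), Or.inl fun x hx => ha ((div_lt_iff₀' hπ).1 hx)⟩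
    · exact ⟨a / (2 * Real.pi), Or.inr fun x hx => ha ((lt_div_iff₀' hπ).1 hx)⟩

/-! ### Band-limited functions and their samples -/

lemma fourier_ae_eq_zero_of_bandlimited {Ω : ℝ} {f : L2}
    (hf : ∀ᵐ ω : ℝ, ω ∈ (Icc (-Ω) Ω)ᶜ → angularFourier f ω = 0) :
    ∀ᵐ ξ : ℝ, ξ ∉ Icc (-(Ω / (2 * Real.pi))) (Ω / (2 * Real.pi)) → (𝓕 f : L2) ξ = 0 := by
  have hπ : (0 : ℝ) < 2 * Real.pi := by positivity
  filter_upwards [ae_fourier_of_ae_angularFourier hf] with ξ h1 hξ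
  refine h1 fun h => hξ ⟨?_, (le_div_iff₀' hπ).2 h.2⟩
  rw [← neg_div]
  exact (div_le_iff₀' hπ).2 h.1

lemma integrable_fourier_of_bandlimited {Ω : ℝ} {f : L2}
    (hf : ∀ᵐ ω : ℝ, ω ∈ (Icc (-Ω) Ω)ᶜ → angularFourier f ω = 0) :
    Integrable (𝓕 f : L2) := by
  refine IntegrableOn.integrable_of_ae_notMem_eq_zero ?_ (fourier_ae_eq_zero_of_bandlimited hf)
  exact ((Lp.memLp (𝓕 f : L2)).restrict _).integrable (by norm_num)

/-- A band-limited function has a continuous representative, the integral of its spectrum. -/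
lemma fourierInv_fourier_ae_eq_of_bandlimited {Ω : ℝ} {f : L2}
    (hf : ∀ᵐ ω : ℝ, ω ∈ (Icc (-Ω) Ω)ᶜ → angularFourier f ω = 0) :
    𝓕⁻ ((𝓕 f : L2) : ℝ → ℂ) =ᵐ[volume] f := by
  have h := Lp_fourierInv_ae_eq_integral (integrable_fourier_of_bandlimited hf)
  rw [FourierTransform.fourierInv_fourier_eq] at h
  exact h.symm

/-- A band-limited function is determined by the samples of its continuous representative at the
points `τ k` with `k ≤ s`, if `τ` is less than the Nyquist step `π / Ω`. -/
theorem eq_zero_of_bandlimited_of_samples {Ω τ : ℝ} (hΩ : 0 < Ω) (hτ : τ ∈ Ioo 0 (Real.pi / Ω))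
    {s : ℤ} {f : L2} (hf : ∀ᵐ ω : ℝ, ω ∈ (Icc (-Ω) Ω)ᶜ → angularFourier f ω = 0)
    {u : ℝ → ℂ} (hu : Continuous u) (huf : u =ᵐ[volume] f) (hs : ∀ k : ℤ, k ≤ s → u (τ * k) = 0) :
    f = 0 := by
  have hπ := Real.pi_pos
  have hueq : u = 𝓕⁻ ((𝓕 f : L2) : ℝ → ℂ) :=
    (hu.ae_eq_iff_eq volume (continuous_fourierInv_of_integrable
      (integrable_fourier_of_bandlimited hf))).1
      (huf.trans (fourierInv_fourier_ae_eq_of_bandlimited hf).symm)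
  have hzero : (𝓕 f : L2) = 0 := by
    refine ae_eq_zero_of_fourierCoeff_eq_zero (B := Ω / (2 * Real.pi)) (T := 1 / τ) (by positivity)
      ?_ s (fourier_ae_eq_zero_of_bandlimited hf) fun k hk => ?_
    · have h1 : τ * Ω < Real.pi := (lt_div_iff₀ hΩ).1 hτ.2
      have h2 : 2 * (Ω / (2 * Real.pi)) = Ω / Real.pi := by field_simp
      rw [h2, div_lt_div_iff₀ hπ hτ.1]
      linarith
    · rw [← hs k hk, hueq, Real.fourierInv_eq']
      congr 1; ext ξ
      rw [smul_eq_mul]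
      congr 2
      have : (τ : ℂ) ≠ 0 := by exact_mod_cast hτ.1.ne'
      simp
      field_simp
  rw [← norm_eq_zero, ← Lp.norm_fourier_eq, hzero, norm_zero]

/-- Equality of two processes with spectrum gaps passes along the chains of `ReachesWithGaps`. -/
lemma eq_of_reachesWithGaps {m : ℕ} {T : Structure m} {G : Fin m → Set ℝ}
    (hG : ∀ d, G d ∈ admissibleSets) {x y : Fin m → L2} (hx : x ∈ gapProcesses T G)
    (hy : y ∈ gapProcesses T G) {d₀ d : Fin m} (hd₀ : x d₀ = y d₀)
    (h : ReachesWithGaps T G d₀ d) : x d = y d := by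
  obtain ⟨j, p, hp0, hpd, hp⟩ := h
  have key : ∀ k : Fin (j + 2), x (p k) = y (p k) := by
    intro k
    induction k using Fin.induction with
    | zero => rw [hp0, hd₀]
    | succ k ih =>
      obtain ⟨hk, hvol⟩ := hp k
      refine eq_of_ae_eq_on_of_gap (T.I ⟨_, hk⟩).2 (hG _) hvol ?_ (hx.2 _) (hy.2 _)
      filter_upwards [hx.1 ⟨_, hk⟩, hy.1 ⟨_, hk⟩] with t h1 h2 ht
      rw [h1 ht, h2 ht, ih]
  rw [← hpd, key]

end BranchedProcess

/-- Branch number `1` of the `m ≥ 1` branches is `0 : Fin m`. The first part of the conclusion says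
that the samples of `x 0` make sense: `x 0` has exactly one continuous representative. -/
theorem corollary3p1 (m : ℕ) [NeZero m] (T : BranchedProcess.Structure m) (G : Fin m → Set ℝ)
    (hG : ∀ d : Fin m, d ≠ 0 → G d ∈ BranchedProcess.admissibleSets)
    (hreach : ∀ d : Fin m, d ≠ 0 → BranchedProcess.ReachesWithGaps T G 0 d)
    (Ω : ℝ) (hΩ : 0 < Ω) (hG0 : G 0 = (Set.Icc (-Ω) Ω)ᶜ)
    (τ : ℝ) (hτ : τ ∈ Set.Ioo 0 (Real.pi / Ω)) (s : ℤ) :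
    (∀ x ∈ BranchedProcess.gapProcesses T G, ∃! u : C(ℝ, ℂ), u =ᵐ[volume] x 0) ∧
    ∀ x ∈ BranchedProcess.gapProcesses T G, ∀ y ∈ BranchedProcess.gapProcesses T G,
      ∀ u v : C(ℝ, ℂ), u =ᵐ[volume] x 0 → v =ᵐ[volume] y 0 →
        (∀ k : ℤ, k ≤ s → u (τ * k) = v (τ * k)) → x = y := by
  have hband : ∀ x ∈ BranchedProcess.gapProcesses T G, ∀ᵐ ω : ℝ, ω ∈ (Icc (-Ω) Ω)ᶜ →
      BranchedProcess.angularFourier (x 0) ω = 0 := fun x hx => by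
    rw [← hG0]; exact hx.2 0
  refine ⟨fun x hx => ?_, fun x hx y hy u v hu hv huv => ?_⟩
  · refine ⟨⟨_, continuous_fourierInv_of_integrable
      (BranchedProcess.integrable_fourier_of_bandlimited (hband x hx))⟩,
      BranchedProcess.fourierInv_fourier_ae_eq_of_bandlimited (hband x hx), fun v hv => ?_⟩
    refine DFunLike.coe_injective ((v.continuous.ae_eq_iff_eq volume (ContinuousMap.continuous _)).1
      (hv.trans (BranchedProcess.fourierInv_fourier_ae_eq_of_bandlimited (hband x hx)).symm))
  · have h0 : x 0 = y 0 := by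
      rw [← sub_eq_zero]
      refine BranchedProcess.eq_zero_of_bandlimited_of_samples hΩ hτ (s := s) ?_
        (u.continuous.sub v.continuous) ?_ (fun k hk => sub_eq_zero.2 (huv k hk))
      · exact BranchedProcess.angularFourier_sub_ae_eq_zero (hband x hx) (hband y hy)
      · filter_upwards [hu, hv, Lp.coeFn_sub (x 0) (y 0)] with t h1 h2 h3
        rw [h3, Pi.sub_apply, Pi.sub_apply, h1, h2]
    have hGall : ∀ d, G d ∈ BranchedProcess.admissibleSets := fun d => by
      by_cases hd : d = 0
      · rw [hd, hG0]
        exact Or.inr ⟨measurableSet_Icc.compl, Ω, Or.inl fun t ht h => not_le.2 ht h.2⟩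
      · exact hG d hd
    funext d
    by_cases hd : d = 0
    · rw [hd, h0]
    · exact BranchedProcess.eq_of_reachesWithGaps hGall hx hy h0 (hreach d hd)
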